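/- Work over $\mathbb{C}$. For a homogeneous polynomial $f\in\mathbb{C}[x_1,\dots,x_n]$ of degree $d$, the border Waring rank $\underline{\mathsf{WR}}(f)$ is the least $r$ such that $$f=\lim_{\epsilon\to0}\sum_{k=1}^r \ell_k^{\,d}$$ (a coefficientwise limit) for some linear forms $\ell_1,\dots,\ell_r$ in $x_1,\dots,x_n$ with coefficients in the field $\mathbb{C}(\epsilon)$ of rational functions. Below, a linear form is a homogeneous polynomial of degree $1$ in $\mathbb{C}[x_1,\dots,x_n]$, or $0$. **Theorem.** (i) Let $f\in\mathbb{C}[x_1,\dots,x_n]$ be homogeneous of degree $d$ with $\underline{\mathsf{WR}}(f)=3$. Then there are linear forms $\ell_1,\ell_2,\ell_3$ such that $f$ is equal to one of $$\ell_1^d+\ell_2^d+\ell_3^d,\qquad \ell_1^d+\ell_2^{d-1}\ell_3,\qquad \ell_1^{d-1}\ell_2+\ell_1^{d-2}\ell_3^2,$$ where the last two forms are to be considered only for $d\ge2$. (The form $\ell_1^{d-2}\ell_3^2$ is the special case $\ell_2=0$ of the third.) (ii) If $d>2$, $a\in\mathbb{C}$, and $\ell_1,\ell_2,\ell_3\in\mathbb{C}[x_1,\dots,x_n]$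 are linearly independent linear forms, then $$\underline{\mathsf{WR}}\bigl(\ell_1^{d-2}(a\ell_1^2+\ell_2\ell_3)\bigr)\ge4 .$$ -/

import Mathlib

open Filter Topology

/-- `f = lim_{ε → 0} F(ε)`, coefficient by coefficient, for a polynomial `F` whose coefficients are
rational functions of `ε`. The limit is over the punctured neighbourhood of `0`, on which each of
the finitely many coefficients has no poles once `ε` is small. -/
def IsLimitAtZero {n : ℕ} (F : MvPolynomial (Fin n) (RatFunc ℂ)) (f : MvPolynomial (Fin n) ℂ) :
    Prop :=
  ∀ m : Fin n →₀ ℕ,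
    Tendsto (fun ε : ℂ => (F.coeff m).eval (RingHom.id ℂ) ε) (𝓝[≠] 0) (𝓝 (f.coeff m))

/-- `f` has a border Waring rank decomposition `f = lim_{ε → 0} ∑_{k = 1}^r ℓ_k ^ d` with `r`
summands, the `ℓ_k` being linear forms with coefficients in `ℂ(ε)`. -/
def HasBorderWaringDecomposition {n : ℕ} (d : ℕ) (f : MvPolynomial (Fin n) ℂ) (r : ℕ) : Prop :=
  ∃ ℓ : Fin r → MvPolynomial (Fin n) (RatFunc ℂ),
    (∀ k, (ℓ k).IsHomogeneous 1) ∧ IsLimitAtZero (∑ k, ℓ k ^ d) f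

/-- The border Waring rank of a form `f` of degree `d`: the minimal number of summands in a border
Waring rank decomposition (`⊤` if there is none). -/
noncomputable def borderWaringRank {n : ℕ} (d : ℕ) (f : MvPolynomial (Fin n) ℂ) : ℕ∞ :=
  ⨅ (r : ℕ) (_ : HasBorderWaringDecomposition d f r), (r : ℕ∞)

/-! For small ε a border decomposition gives three complex coefficient vectors, and the d-th powers
of their linear forms sum to something tending to f. Along an ultrafilter finer than the punctured
neighbourhood of 0, each vector converges or diverges with a convergent direction
(`Ultrafilter.tendsto_or_diverges`). A convergent vector splits off a d-th power and leaves the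
problem with two forms.

If all three diverge, no limit direction can differ from both others: a second difference would
isolate its unbounded power (`PowerSumTendsto.proportional_or`). So all three collide at one form A.
After normalisation the sum is governed by weighted moments of the displacements from A. These obey
a linear recurrence whose coefficients tend to 0, so only orders 0, 1, 2 survive
(`exists_tendsto_moments`), and the quadratic form of second moments has rank at most one
(`tendsto_second_moments`). The limit is A^(d-1) B + A^(d-2) C^2, with C = 0 when only two forms
collide.

For the lower bound, rank at most 3 would give the form one of these shapes. In coordinates x, y, z
it vanishes at x = 0 because d > 2, which makes the y, z parts of the candidate forms degenerate.
This contradicts the fact that no nonzero translation changes yz by only a constant. -/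

/-! ### Linear forms and coefficient vectors -/

section LinearForms

open MvPolynomial

theorem MvPolynomial.IsHomogeneous.eq_sum_C_mul_X {R : Type*} [CommSemiring R] {n : ℕ}
    {p : MvPolynomial (Fin n) R} (hp : p.IsHomogeneous 1) :
    p = ∑ i, C (p.coeff (Finsupp.single i 1)) * X i := by
  ext m
  simp only [coeff_sum, coeff_C_mul, coeff_X]
  by_cases hm : m.degree = 1
  · obtain ⟨i, rfl⟩ : ∃ i, m = Finsupp.single i 1 := by
      obtain ⟨i, hi⟩ := (Finsupp.sum_eq_one_iff m).1 (by simpa [Finsupp.degree_eq_sum, Finsupp.sum_fintype] using hm)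
      exact ⟨i, hi⟩
    rw [Finset.sum_eq_single i]
    · simp
    · intro j _ hj
      rw [if_neg, mul_zero]
      intro h
      exact hj (Finsupp.single_left_injective one_ne_zero h)
    · simp
  · rw [hp.coeff_eq_zero hm, Finset.sum_eq_zero]
    intro i _
    rw [if_neg, mul_zero]
    rintro rfl
    simp at hm

/-- The linear form with a given vector of coefficients. -/
noncomputable def linearFormOf {n : ℕ} (v : Fin n → ℂ) : MvPolynomial (Fin n) ℂ :=
  ∑ i, C (v i) * X i

theorem isHomogeneous_linearFormOf {n : ℕ} (v : Fin n → ℂ) : (linearFormOf v).IsHomogeneous 1 :=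
  IsHomogeneous.sum _ _ _ fun i _ => isHomogeneous_C_mul_X (v i) i

@[simp]
theorem eval_linearFormOf {n : ℕ} (v y : Fin n → ℂ) : eval y (linearFormOf v) = v ⬝ᵥ y := by
  simp [linearFormOf, dotProduct]

theorem exists_eq_linearFormOf {n : ℕ} {p : MvPolynomial (Fin n) ℂ} (hp : p.IsHomogeneous 1) :
    ∃ v, p = linearFormOf v :=
  ⟨_, hp.eq_sum_C_mul_X⟩

end LinearForms

/-! ### From rational functions of ε to complex numbers -/

section Specialization

/-- The rational functions that are regular at `a`. -/
noncomputable def regularAt (a : ℂ) : Subring (RatFunc ℂ) where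
  carrier := {r | r.denom.eval₂ (RingHom.id ℂ) a ≠ 0}
  mul_mem' {x y} hx hy h := by
    have := Polynomial.eval₂_eq_zero_of_dvd_of_eval₂_eq_zero _ a (RatFunc.denom_mul_dvd x y) h
    rw [Polynomial.eval₂_mul] at this
    exact (mul_ne_zero hx hy) this
  add_mem' {x y} hx hy h := by
    have := Polynomial.eval₂_eq_zero_of_dvd_of_eval₂_eq_zero _ a (RatFunc.denom_add_dvd x y) h
    rw [Polynomial.eval₂_mul] at this
    exact (mul_ne_zero hx hy) this
  one_mem' := by simp
  zero_mem' := by simp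
  neg_mem' {x} hx h := by
    have hd : (-x).denom ∣ x.denom := by
      have h1 := RatFunc.denom_mul_dvd (RatFunc.C (-1)) x
      rw [RatFunc.denom_C, one_mul] at h1
      simpa using h1
    exact hx (Polynomial.eval₂_eq_zero_of_dvd_of_eval₂_eq_zero _ a hd h)

/-- Evaluation at `a` of the rational functions regular there. -/
noncomputable def regularEval (a : ℂ) : regularAt a →+* ℂ where
  toFun r := (r : RatFunc ℂ).eval (RingHom.id ℂ) a
  map_one' := by simp
  map_zero' := by simp
  map_mul' x y := RatFunc.eval_mul _ a x.2 y.2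
  map_add' x y := RatFunc.eval_add _ a x.2 y.2

theorem eventually_mem_regularAt (r : RatFunc ℂ) : ∀ᶠ a in 𝓝[≠] (0 : ℂ), r ∈ regularAt a := by
  have hfin : ((r.denom.roots.toFinset : Set ℂ) \ {0}).Finite :=
    (Finset.finite_toSet _).subset Set.sdiff_subset
  have h : ∀ᶠ a in 𝓝 (0 : ℂ), a ∉ (r.denom.roots.toFinset : Set ℂ) \ {0} :=
    hfin.isClosed.isOpen_compl.mem_nhds (by simp)
  filter_upwards [nhdsWithin_le_nhds h, self_mem_nhdsWithin] with a ha ha0 hr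
  refine ha ⟨?_, ha0⟩
  simp only [Finset.mem_coe, Multiset.mem_toFinset]
  rw [Polynomial.mem_roots r.denom_ne_zero]
  exact hr

/-- A border decomposition provides vectors `v k ε` of coefficients such that the sums of powers of
linear forms converge continuously. -/
theorem IsLimitAtZero.exists_tendsto {n d r : ℕ} {f : MvPolynomial (Fin n) ℂ}
    {ℓ : Fin r → MvPolynomial (Fin n) (RatFunc ℂ)} (hℓ : ∀ k, (ℓ k).IsHomogeneous 1)
    (h : IsLimitAtZero (∑ k, ℓ k ^ d) f) :
    ∃ v : Fin r → ℂ → Fin n → ℂ, ∀ l : Filter ℂ, l ≤ 𝓝[≠] 0 → ∀ (y : ℂ → Fin n → ℂ) y₀,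
      Tendsto y l (𝓝 y₀) →
      Tendsto (fun ε => ∑ k, (v k ε ⬝ᵥ y ε) ^ d) l (𝓝 (MvPolynomial.eval y₀ f)) := by
  classical
  let c : Fin r → Fin n → RatFunc ℂ := fun k i => (ℓ k).coeff (Finsupp.single i 1)
  let v : Fin r → ℂ → Fin n → ℂ := fun k ε i => (c k i).eval (RingHom.id ℂ) ε
  have hcoeff : ∀ᶠ ε in 𝓝[≠] (0 : ℂ), ∀ m,
      (∑ k, linearFormOf (v k ε) ^ d).coeff m =
        ((∑ k, ℓ k ^ d).coeff m).eval (RingHom.id ℂ) ε := by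
    have hreg : ∀ᶠ ε in 𝓝[≠] (0 : ℂ), ∀ k i, c k i ∈ regularAt ε :=
      eventually_all.2 fun k => eventually_all.2 fun i => eventually_mem_regularAt _
    filter_upwards [hreg] with ε hε m
    -- `RatFunc.eval` respects sums and products only away from poles. Lifting to the subring of
    -- functions regular at ε makes evaluation a ring homomorphism, which commutes with expanding
    -- the powers.
    let g : MvPolynomial (Fin n) (regularAt ε) :=
      ∑ k, (∑ i, MvPolynomial.C ⟨c k i, hε k i⟩ * MvPolynomial.X i) ^ d
    have h1 : ∑ k, ℓ k ^ d = MvPolynomial.map (regularAt ε).subtype g := by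
      simp only [g, map_sum, map_pow, map_mul, MvPolynomial.map_C, MvPolynomial.map_X]
      refine Finset.sum_congr rfl fun k _ => ?_
      rw [(hℓ k).eq_sum_C_mul_X]
      rfl
    have h2 : ∑ k, linearFormOf (v k ε) ^ d = MvPolynomial.map (regularEval ε) g := by
      simp only [g, map_sum, map_pow, map_mul, MvPolynomial.map_C, MvPolynomial.map_X]
      rfl
    rw [h1, h2, MvPolynomial.coeff_map, MvPolynomial.coeff_map]
    rfl
  refine ⟨v, fun l hl y y₀ hy => ?_⟩
  set F := ∑ k, ℓ k ^ d with hF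
  let S := F.support ∪ f.support
  have hf : MvPolynomial.eval y₀ f = ∑ m ∈ S, f.coeff m * ∏ i, y₀ i ^ m i := by
    rw [MvPolynomial.eval_eq']
    refine Finset.sum_subset Finset.subset_union_right fun m _ hm => ?_
    rw [MvPolynomial.notMem_support_iff.1 hm, zero_mul]
  have hlim : Tendsto
      (fun ε => ∑ m ∈ S, (F.coeff m).eval (RingHom.id ℂ) ε * ∏ i, y ε i ^ m i) l
      (𝓝 (∑ m ∈ S, f.coeff m * ∏ i, y₀ i ^ m i)) := by
    refine tendsto_finsetSum _ fun m _ => ((h m).mono_left hl).mul ?_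
    exact tendsto_finsetProd _ fun i _ => ((tendsto_pi_nhds.1 hy) i).pow _
  rw [hf]
  refine hlim.congr' ?_
  filter_upwards [hl hcoeff] with ε hε
  have h3 : ∑ k, (v k ε ⬝ᵥ y ε) ^ d =
      MvPolynomial.eval (y ε) (∑ k, linearFormOf (v k ε) ^ d) := by simp
  rw [h3, MvPolynomial.eval_eq']
  simp only [hε]
  refine (Finset.sum_subset (fun m hm => ?_) fun m _ hm => ?_).symm
  · rw [MvPolynomial.mem_support_iff, hε] at hm
    refine Finset.mem_union_left _ (MvPolynomial.mem_support_iff.2 fun h0 => hm ?_)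
    rw [h0, RatFunc.eval_zero]
  · rw [MvPolynomial.notMem_support_iff, hε] at hm
    rw [hm, zero_mul]

end Specialization

/-! ### Collision of three forms: moments of the displacements -/

section Collapse

/-- By Lagrange interpolation at 0, ..., d, each coefficient is a fixed linear combination of d + 1
values. -/
theorem exists_tendsto_coeff_of_tendsto_eval {α : Type*} {l : Filter α} {d : ℕ}
    {P : α → Polynomial ℂ} (hP : ∀ a, (P a).natDegree ≤ d) {g : ℂ → ℂ}
    (h : ∀ σ, Tendsto (fun a => (P a).eval σ) l (𝓝 (g σ))) (j : ℕ) :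
    ∃ c, Tendsto (fun a => (P a).coeff j) l (𝓝 c) := by
  have key : ∀ a, (P a).coeff j = ∑ i ∈ Finset.range (d + 1),
      (P a).eval (i : ℂ) * (Lagrange.basis (Finset.range (d + 1)) (fun i : ℕ => (i : ℂ)) i).coeff j
      := by
    intro a
    have h1 := Lagrange.eq_interpolate (s := Finset.range (d + 1)) (v := fun i : ℕ => (i : ℂ))
      (f := P a) Nat.cast_injective.injOn (by
        rw [Finset.card_range]
        exact lt_of_le_of_lt Polynomial.degree_le_natDegree
          (by exact_mod_cast Nat.lt_succ_of_le (hP a)))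
    conv_lhs => rw [h1, Lagrange.interpolate_apply]
    simp [Polynomial.coeff_C_mul]
  simp only [key]
  exact ⟨_, tendsto_finsetSum _ fun i _ => (h i).mul_const _⟩

variable {α : Type*} {l : Filter α}

/-- Each `μ k` is a root of the monic cubic with roots `μ 0`, `μ 1`, `μ 2`. -/
theorem power_sum_recurrence (w μ : Fin 3 → ℂ) (j : ℕ) :
    ∑ k, w k * μ k ^ (j + 3) =
      (μ 0 + μ 1 + μ 2) * ∑ k, w k * μ k ^ (j + 2)
        - (μ 0 * μ 1 + μ 0 * μ 2 + μ 1 * μ 2) * ∑ k, w k * μ k ^ (j + 1)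
        + μ 0 * μ 1 * μ 2 * ∑ k, w k * μ k ^ j := by
  simp only [Fin.sum_univ_three]
  ring

/-- The moments of order at most d are, up to binomials, coefficients in σ, so they converge. Since
the recurrence coefficients tend to 0, every moment of order at least 3 tends to 0. -/
theorem exists_tendsto_moments [l.NeBot] {d : ℕ} (hd : 2 ≤ d) {w μ : Fin 3 → α → ℂ} {g : ℂ → ℂ}
    (hμ : ∀ k, Tendsto (μ k) l (𝓝 0))
    (h : ∀ σ, Tendsto (fun a => ∑ k, w k a * (σ + μ k a) ^ d) l (𝓝 (g σ))) :
    ∃ τ : Fin 3 → ℂ, (∀ j : Fin 3, Tendsto (fun a => ∑ k, w k a * μ k a ^ (j : ℕ)) l (𝓝 (τ j))) ∧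
      ∀ σ, g σ = τ 0 * σ ^ d + d * τ 1 * σ ^ (d - 1) + d.choose 2 * τ 2 * σ ^ (d - 2) := by
  obtain ⟨e, rfl⟩ := Nat.exists_eq_add_of_le' hd
  have hT : ∀ j ≤ e + 2, ∃ c, Tendsto (fun a => ∑ k, w k a * μ k a ^ j) l (𝓝 c) := by
    intro j hj
    let P : α → Polynomial ℂ := fun a =>
      ∑ k, Polynomial.C (w k a) * (Polynomial.X + Polynomial.C (μ k a)) ^ (e + 2)
    obtain ⟨c, hc⟩ := exists_tendsto_coeff_of_tendsto_eval (P := P) (d := e + 2) (g := g)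
      (fun a => Polynomial.natDegree_sum_le_of_forall_le _ _ fun k _ => by
        refine (Polynomial.natDegree_C_mul_le _ _).trans ?_
        rw [Polynomial.natDegree_pow, Polynomial.natDegree_X_add_C, mul_one])
      (fun σ => by simpa [P, Polynomial.eval_finsetSum] using h σ) (e + 2 - j)
    refine ⟨c / (e + 2).choose (e + 2 - j), (hc.div_const _).congr fun a => ?_⟩
    have hne : ((e + 2).choose (e + 2 - j) : ℂ) ≠ 0 :=
      Nat.cast_ne_zero.2 (Nat.choose_pos (Nat.sub_le _ _)).ne'
    rw [div_eq_iff hne, Finset.sum_mul]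
    simp only [P, Polynomial.finsetSum_coeff, Polynomial.coeff_C_mul,
      Polynomial.coeff_X_add_C_pow, Nat.sub_sub_self hj, mul_assoc]
  have hzero : ∀ j, Tendsto (fun a => ∑ k, w k a * μ k a ^ (j + 3)) l (𝓝 0) := by
    have step : ∀ j, (∀ i < 3, ∃ c, Tendsto (fun a => ∑ k, w k a * μ k a ^ (j + i)) l (𝓝 c)) →
        Tendsto (fun a => ∑ k, w k a * μ k a ^ (j + 3)) l (𝓝 0) := by
      intro j hj
      obtain ⟨c₀, h₀⟩ := hj 0 (by norm_num)
      obtain ⟨c₁, h₁⟩ := hj 1 (by norm_num)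
      obtain ⟨c₂, h₂⟩ := hj 2 (by norm_num)
      simp only [power_sum_recurrence]
      have := (((((hμ 0).add (hμ 1)).add (hμ 2)).mul h₂).sub
        (((((hμ 0).mul (hμ 1)).add ((hμ 0).mul (hμ 2))).add ((hμ 1).mul (hμ 2))).mul h₁)).add
        ((((hμ 0).mul (hμ 1)).mul (hμ 2)).mul h₀)
      simpa using this
    have all : ∀ j, ∀ i < 3, ∃ c, Tendsto (fun a => ∑ k, w k a * μ k a ^ (j + i)) l (𝓝 c) := by
      intro j
      induction j with
      | zero =>
        intro i hi
        rw [zero_add]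
        exact hT i (by omega)
      | succ j ih =>
        intro i hi
        by_cases hi2 : i = 2
        · subst hi2
          exact ⟨0, step j ih⟩
        · obtain ⟨c, hc⟩ := ih (i + 1) (by omega)
          exact ⟨c, by simpa only [add_assoc, add_comm 1 i] using hc⟩
    exact fun j => step j (all j)
  choose τ hτ using fun j : Fin 3 => hT j (by omega)
  refine ⟨τ, hτ, fun σ => tendsto_nhds_unique (h σ) ?_⟩
  have hexp : ∀ a, ∑ k, w k a * (σ + μ k a) ^ (e + 2) = ∑ m ∈ Finset.range (e + 3),
      (∑ k, w k a * μ k a ^ m) * (σ ^ (e + 2 - m) * (e + 2).choose m) := by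
    intro a
    simp only [Finset.sum_mul]
    rw [Finset.sum_comm]
    refine Finset.sum_congr rfl fun k _ => ?_
    rw [add_comm, add_pow, Finset.mul_sum]
    exact Finset.sum_congr rfl fun m _ => by ring
  simp only [hexp]
  simp only [Finset.sum_range_succ' _ (e + 2), Finset.sum_range_succ' _ (e + 1),
    Finset.sum_range_succ' _ e]
  have hs : Tendsto (fun a => ∑ m ∈ Finset.range e, (∑ k, w k a * μ k a ^ (m + 1 + 1 + 1)) *
      (σ ^ (e + 2 - (m + 1 + 1 + 1)) * (e + 2).choose (m + 1 + 1 + 1))) l (𝓝 0) := by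
    have := tendsto_finsetSum (Finset.range e) fun m _ =>
      (hzero m).mul_const (σ ^ (e + 2 - (m + 1 + 1 + 1)) * ((e + 2).choose (m + 1 + 1 + 1) : ℂ))
    simpa using this
  have := ((hs.add ((hτ 2).mul_const (σ ^ (e + 2 - 2) * ((e + 2).choose 2 : ℂ)))).add
    ((hτ 1).mul_const (σ ^ (e + 2 - 1) * ((e + 2).choose 1 : ℂ)))).add
    ((hτ 0).mul_const (σ ^ (e + 2 - 0) * ((e + 2).choose 0 : ℂ)))
  convert this using 2
  · simp
  · rw [Nat.choose_zero_right, Nat.choose_one_right, Nat.sub_zero]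
    ring

theorem exists_tendsto_of_tendsto_dotProduct {n : ℕ} {W : α → Fin n → ℂ} {τ : (Fin n → ℂ) → ℂ}
    (h : ∀ x, Tendsto (fun a => W a ⬝ᵥ x) l (𝓝 (τ x))) : ∃ W₀, Tendsto W l (𝓝 W₀) :=
  ⟨fun i => τ (Pi.single i 1), tendsto_pi_nhds.2 fun i => by simpa using h (Pi.single i 1)⟩

theorem Filter.Tendsto.dotProduct {n : ℕ} {v y : α → Fin n → ℂ} {v₀ y₀ : Fin n → ℂ}
    (hv : Tendsto v l (𝓝 v₀)) (hy : Tendsto y l (𝓝 y₀)) :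
    Tendsto (fun a => v a ⬝ᵥ y a) l (𝓝 (v₀ ⬝ᵥ y₀)) :=
  tendsto_finsetSum _ fun i _ => ((tendsto_pi_nhds.1 hv) i).mul ((tendsto_pi_nhds.1 hy) i)

/-- A limit of squares of symmetric `2 × 2` minors vanishes: the second moments of three colliding
points form a quadratic form of rank at most one. -/
theorem tendsto_second_moments [l.NeBot] {w p q : Fin 3 → α → ℂ}
    {t₀ p₁ q₁ pp pq qq : ℂ} (hp : ∀ k, Tendsto (p k) l (𝓝 0)) (hq : ∀ k, Tendsto (q k) l (𝓝 0))
    (h₀ : Tendsto (fun a => ∑ k, w k a) l (𝓝 t₀))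
    (hp₁ : Tendsto (fun a => ∑ k, w k a * p k a) l (𝓝 p₁))
    (hq₁ : Tendsto (fun a => ∑ k, w k a * q k a) l (𝓝 q₁))
    (hpp : Tendsto (fun a => ∑ k, w k a * (p k a * p k a)) l (𝓝 pp))
    (hpq : Tendsto (fun a => ∑ k, w k a * (p k a * q k a)) l (𝓝 pq))
    (hqq : Tendsto (fun a => ∑ k, w k a * (q k a * q k a)) l (𝓝 qq)) :
    pp * qq = pq ^ 2 := by
  simp only [Fin.sum_univ_three] at *
  have hdp : ∀ k, Tendsto (fun a => p k a - p 0 a) l (𝓝 0) := fun k => by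
    simpa using (hp k).sub (hp 0)
  have hdq : ∀ k, Tendsto (fun a => q k a - q 0 a) l (𝓝 0) := fun k => by
    simpa using (hq k).sub (hq 0)
  -- Taking point 0 as origin removes its contribution and leaves the limits unchanged.
  have hP : Tendsto (fun a => w 1 a * (p 1 a - p 0 a) + w 2 a * (p 2 a - p 0 a)) l (𝓝 p₁) := by
    have := hp₁.sub ((hp 0).mul h₀)
    simp only [zero_mul, sub_zero] at this
    exact this.congr fun a => by ring
  have hQ : Tendsto (fun a => w 1 a * (q 1 a - q 0 a) + w 2 a * (q 2 a - q 0 a)) l (𝓝 q₁) := by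
    have := hq₁.sub ((hq 0).mul h₀)
    simp only [zero_mul, sub_zero] at this
    exact this.congr fun a => by ring
  have hPP : Tendsto (fun a => w 1 a * ((p 1 a - p 0 a) * (p 1 a - p 0 a)) +
      w 2 a * ((p 2 a - p 0 a) * (p 2 a - p 0 a))) l (𝓝 pp) := by
    have := (hpp.sub ((hp 0).mul (hp₁.add hP)))
    simp only [zero_mul, sub_zero] at this
    exact this.congr fun a => by ring
  have hQQ : Tendsto (fun a => w 1 a * ((q 1 a - q 0 a) * (q 1 a - q 0 a)) +
      w 2 a * ((q 2 a - q 0 a) * (q 2 a - q 0 a))) l (𝓝 qq) := by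
    have := (hqq.sub ((hq 0).mul (hq₁.add hQ)))
    simp only [zero_mul, sub_zero] at this
    exact this.congr fun a => by ring
  have hPQ : Tendsto (fun a => w 1 a * ((p 1 a - p 0 a) * (q 1 a - q 0 a)) +
      w 2 a * ((p 2 a - p 0 a) * (q 2 a - q 0 a))) l (𝓝 pq) := by
    have := (hpq.sub ((hp 0).mul hq₁)).sub ((hq 0).mul hP)
    simp only [zero_mul, sub_zero] at this
    exact this.congr fun a => by ring
  -- With Δ the determinant of the two remaining displacements, these quantities are w₂Δ and w₁Δ.
  -- Both tend to 0, and their product w₁w₂Δ² is the determinant of the second moments.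
  have h1 := ((hdp 1).mul hQ).sub ((hdq 1).mul hP)
  have h2 := ((hdq 2).mul hP).sub ((hdp 2).mul hQ)
  have h3 := (hPP.mul hQQ).sub (hPQ.pow 2)
  have h4 := h1.mul h2
  simp only [zero_mul, sub_zero] at h4
  exact sub_eq_zero.1 (tendsto_nhds_unique (h3.congr fun a => by ring) h4)

/-- The final clause treats two colliding points as three, one of weight zero and repeated position.
-/
theorem exists_eq_of_tendsto_collapse [l.NeBot] {n d : ℕ} (hd : 2 ≤ d) {w : Fin 3 → α → ℂ}
    {m : Fin 3 → α → Fin n → ℂ} {g : (Fin n → ℂ) → ℂ → ℂ} (hm : ∀ k, Tendsto (m k) l (𝓝 0))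
    (h : ∀ x σ, Tendsto (fun a => ∑ k, w k a * (σ + m k a ⬝ᵥ x) ^ d) l (𝓝 (g x σ))) :
    ∃ (t : ℂ) (B C : Fin n → ℂ),
      (∀ x σ, g x σ = t * σ ^ d + (B ⬝ᵥ x) * σ ^ (d - 1) + (C ⬝ᵥ x) ^ 2 * σ ^ (d - 2)) ∧
      (w 0 = 0 → m 0 = m 1 → C = 0) := by
  have hmx : ∀ k x, Tendsto (fun a => m k a ⬝ᵥ x) l (𝓝 0) := fun k x => by
    simpa using (hm k).dotProduct (tendsto_const_nhds (x := x))
  choose τ hτ hg using fun x => exists_tendsto_moments hd (fun k => hmx k x) (h x)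
  have hT₀ : ∀ x, Tendsto (fun a => ∑ k, w k a) l (𝓝 (τ x 0)) := fun x => by
    simpa using hτ x 0
  have hT₁ : ∀ x, Tendsto (fun a => ∑ k, w k a * (m k a ⬝ᵥ x)) l (𝓝 (τ x 1)) := fun x => by
    simpa using hτ x 1
  have hT₂ : ∀ x, Tendsto (fun a => ∑ k, w k a * ((m k a ⬝ᵥ x) * (m k a ⬝ᵥ x))) l
      (𝓝 (τ x 2)) := fun x => by
    simpa [sq] using hτ x 2
  have hB : ∀ x y, Tendsto (fun a => ∑ k, w k a * ((m k a ⬝ᵥ x) * (m k a ⬝ᵥ y))) l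
      (𝓝 ((τ (x + y) 2 - τ x 2 - τ y 2) / 2)) := fun x y => by
    refine ((((hT₂ (x + y)).sub (hT₂ x)).sub (hT₂ y)).div_const 2).congr fun a => ?_
    simp only [Fin.sum_univ_three, dotProduct_add]
    ring
  obtain ⟨W, hW⟩ : ∃ W, Tendsto (fun a => ∑ k, w k a • m k a) l (𝓝 W) :=
    exists_tendsto_of_tendsto_dotProduct (τ := fun x => τ x 1) fun x => by
      simpa [sum_dotProduct] using hT₁ x
  have hW₁ : ∀ x, τ x 1 = W ⬝ᵥ x := fun x => by
    refine tendsto_nhds_unique (hT₁ x) ?_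
    simpa [sum_dotProduct] using hW.dotProduct (tendsto_const_nhds (x := x))
  have ht : ∀ x, τ x 0 = τ 0 0 := fun x => tendsto_nhds_unique (hT₀ x) (hT₀ 0)
  -- The square root c absorbs the binomial coefficient into C.
  obtain ⟨c, hc⟩ := IsAlgClosed.exists_pow_nat_eq (d.choose 2 : ℂ) (n := 2) (by norm_num)
  have hmain : ∃ C : Fin n → ℂ, ∀ x, τ x 2 = (C ⬝ᵥ x) ^ 2 := by
    by_cases hall : ∀ x, τ x 2 = 0
    · exact ⟨0, by simpa using hall⟩
    push Not at hall
    obtain ⟨y, hy⟩ := hall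
    obtain ⟨s, hs⟩ := IsAlgClosed.exists_pow_nat_eq (τ y 2) (n := 2) (by norm_num)
    have hs0 : s ≠ 0 := by
      rintro rfl
      exact hy (by simpa using hs.symm)
    -- V is the polar form of the second moments against y. Rank one gives τ y 2 * τ x 2 = (V ⬝ᵥ
    -- x)², so V divided by a root of τ y 2 works.
    obtain ⟨V, hV⟩ : ∃ V, Tendsto (fun a => ∑ k, (w k a * (m k a ⬝ᵥ y)) • m k a) l (𝓝 V) :=
      exists_tendsto_of_tendsto_dotProduct (τ := fun x => (τ (y + x) 2 - τ y 2 - τ x 2) / 2)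
        fun x => by simpa [sum_dotProduct, mul_assoc] using hB y x
    refine ⟨s⁻¹ • V, fun x => ?_⟩
    have hVx : Tendsto (fun a => ∑ k, w k a * ((m k a ⬝ᵥ y) * (m k a ⬝ᵥ x))) l
        (𝓝 (V ⬝ᵥ x)) := by
      simpa [sum_dotProduct, mul_assoc] using hV.dotProduct (tendsto_const_nhds (x := x))
    have := tendsto_second_moments (fun k => hmx k y) (fun k => hmx k x) (hT₀ 0) (hT₁ y) (hT₁ x)
      (hT₂ y) hVx (hT₂ x)
    rw [smul_dotProduct, smul_eq_mul, mul_pow, ← this, ← hs]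
    field_simp
  by_cases hdeg : w 0 = 0 ∧ m 0 = m 1
  · have hz : ∀ x, τ x 2 = 0 := fun x => by
      refine tendsto_nhds_unique (hT₂ x) ?_
      have := (((hmx 2 x).sub (hmx 0 x)).mul ((hT₁ x).sub ((hmx 0 x).mul (hT₀ x)))).add
        (((hmx 0 x).mul (hT₁ x)).add ((hmx 0 x).mul ((hT₁ x).sub ((hmx 0 x).mul (hT₀ x)))))
      simp only [zero_mul, sub_zero, add_zero] at this
      refine this.congr fun a => ?_
      simp only [Fin.sum_univ_three, hdeg.1, ← hdeg.2, Pi.zero_apply]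
      ring
    refine ⟨τ 0 0, (d : ℂ) • W, 0, fun x σ => ?_, fun _ _ => rfl⟩
    rw [hg x σ, hz, hW₁, ht x]
    simp
  · obtain ⟨C, hC⟩ := hmain
    refine ⟨τ 0 0, (d : ℂ) • W, c • C, fun x σ => ?_, fun h1 h2 => (hdeg ⟨h1, h2⟩).elim⟩
    rw [hg x σ, hC, hW₁, ht x, smul_dotProduct, smul_dotProduct, smul_eq_mul, smul_eq_mul,
      mul_pow, hc]

end Collapse

/-! ### Limits of sums of at most three powers -/

section Classification

variable {α : Type*} {n d : ℕ}

/-- The sums `v₁ ^ d + v₂ ^ d + v₃ ^ d` of powers of linear forms converge continuously to `g`. -/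
def PowerSumTendsto (l : Filter α) (d : ℕ) (v₁ v₂ v₃ : α → Fin n → ℂ) (g : (Fin n → ℂ) → ℂ) :
    Prop :=
  ∀ (y : α → Fin n → ℂ) (y₀ : Fin n → ℂ), Tendsto y l (𝓝 y₀) →
    Tendsto (fun a => (v₁ a ⬝ᵥ y a) ^ d + (v₂ a ⬝ᵥ y a) ^ d + (v₃ a ⬝ᵥ y a) ^ d) l (𝓝 (g y₀))

theorem PowerSumTendsto.rotate {l : Filter α} {v₁ v₂ v₃ : α → Fin n → ℂ} {g : (Fin n → ℂ) → ℂ}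
    (h : PowerSumTendsto l d v₁ v₂ v₃ g) : PowerSumTendsto l d v₂ v₃ v₁ g :=
  fun y y₀ hy => (h y y₀ hy).congr fun a => by ring

/-- Proportionality of linear forms. -/
def Proportional (u v : Fin n → ℂ) : Prop :=
  ∀ x y, (u ⬝ᵥ x) * (v ⬝ᵥ y) = (u ⬝ᵥ y) * (v ⬝ᵥ x)

theorem Proportional.symm {u v : Fin n → ℂ} (h : Proportional u v) : Proportional v u :=
  fun x y => by linear_combination -h x y

theorem exists_dotProduct_ne_zero {u : Fin n → ℂ} (hu : u ≠ 0) : ∃ x, u ⬝ᵥ x ≠ 0 := by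
  by_contra! h
  exact hu (dotProduct_eq_zero_iff.1 h)

theorem Proportional.dotProduct_ne_zero {u v : Fin n → ℂ} (h : Proportional u v) (hv : v ≠ 0)
    {x : Fin n → ℂ} (hx : u ⬝ᵥ x ≠ 0) : v ⬝ᵥ x ≠ 0 := by
  intro h0
  obtain ⟨y, hy⟩ := exists_dotProduct_ne_zero hv
  have := h x y
  rw [h0, mul_zero] at this
  exact mul_ne_zero hx hy this

theorem Proportional.trans {u v w : Fin n → ℂ} (h : Proportional u v) (h' : Proportional v w)
    (hv : v ≠ 0) : Proportional u w := by
  obtain ⟨e, he⟩ := exists_dotProduct_ne_zero hv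
  intro x y
  have e1 := h e x
  have e2 := h e y
  have e3 := h' e x
  have e4 := h' e y
  have : ((v ⬝ᵥ e) * (v ⬝ᵥ e)) * ((u ⬝ᵥ x) * (w ⬝ᵥ y) - (u ⬝ᵥ y) * (w ⬝ᵥ x)) = 0 := by
    linear_combination (-(v ⬝ᵥ e) * (w ⬝ᵥ y)) * e1 + ((v ⬝ᵥ e) * (w ⬝ᵥ x)) * e2
      + (u ⬝ᵥ e) * (v ⬝ᵥ x) * e4 - (u ⬝ᵥ e) * (v ⬝ᵥ y) * e3
  rcases mul_eq_zero.1 this with h0 | h0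
  · exact absurd h0 (mul_ne_zero he he)
  · exact sub_eq_zero.1 h0

/-- A vector sequence along an ultrafilter converges, or diverges in a convergent direction. -/
theorem Ultrafilter.tendsto_or_diverges (U : Ultrafilter α) (v : α → Fin n → ℂ) :
    (∃ v₀, Tendsto v U (𝓝 v₀)) ∨
      ∃ (r : α → ℂ) (u : α → Fin n → ℂ) (u₀ : Fin n → ℂ), u₀ ≠ 0 ∧ Tendsto u U (𝓝 u₀) ∧
        Tendsto (fun a => ‖r a‖) U atTop ∧ ∀ a, v a = r a • u a := by
  by_cases hb : ∃ R, ∀ᶠ a in (U : Filter α), v a ∈ Metric.closedBall 0 R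
  · obtain ⟨R, hR⟩ := hb
    obtain ⟨v₀, -, hv₀⟩ := (isCompact_closedBall (0 : Fin n → ℂ) R).ultrafilter_le_nhds
      (U.map v) (le_principal_iff.2 hR)
    exact Or.inl ⟨v₀, hv₀⟩
  -- For an ultrafilter, failing to be eventually in a ball means being eventually outside it.
  · simp only [not_exists, ← Ultrafilter.eventually_not] at hb
    have hlarge : Tendsto (fun a => ‖v a‖) U atTop := by
      refine tendsto_atTop.2 fun R => ?_
      filter_upwards [hb R] with a ha
      simpa using (not_le.1 (mt mem_closedBall_zero_iff.2 ha)).le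
    let u : α → Fin n → ℂ := fun a => ((‖v a‖ : ℂ))⁻¹ • v a
    have hball : ∀ᶠ a in (U : Filter α), u a ∈ Metric.closedBall 0 1 :=
      Eventually.of_forall fun a => by
        rw [mem_closedBall_zero_iff, norm_smul, norm_inv, Complex.norm_real, norm_norm]
        exact inv_mul_le_one
    obtain ⟨u₀, -, hu₀⟩ := (isCompact_closedBall (0 : Fin n → ℂ) 1).ultrafilter_le_nhds
      (U.map u) (le_principal_iff.2 hball)
    have hu : Tendsto u U (𝓝 u₀) := hu₀
    refine Or.inr ⟨fun a => ‖v a‖, u, u₀, ?_, hu, by simpa using hlarge, fun a => ?_⟩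
    · have h1 : Tendsto (fun a => ‖u a‖) U (𝓝 1) := by
        refine tendsto_const_nhds.congr' ?_
        filter_upwards [hlarge.eventually_gt_atTop 0] with a ha
        simp only [u, norm_smul, norm_inv, Complex.norm_real, norm_norm]
        exact (inv_mul_cancel₀ ha.ne').symm
      have h2 := tendsto_nhds_unique h1 hu.norm
      rintro rfl
      simp at h2
    · by_cases h0 : v a = 0
      · simp [u, h0]
      · have : (‖v a‖ : ℂ) ≠ 0 := by simpa using h0
        simp only [u, smul_smul, mul_inv_cancel₀ this, one_smul]

variable {l : Filter α} {v₁ v₂ v₃ : α → Fin n → ℂ} {g : (Fin n → ℂ) → ℂ}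

theorem not_tendsto_pow_mul [l.NeBot] (hd : d ≠ 0) {r s : α → ℂ} {s₀ c : ℂ}
    (hr : Tendsto (fun a => ‖r a‖) l atTop) (hs : Tendsto s l (𝓝 s₀)) (hs₀ : s₀ ≠ 0)
    (h : Tendsto (fun a => (r a * s a) ^ d) l (𝓝 c)) : False := by
  have h1 : Tendsto (fun a => ‖r a‖ * ‖s a‖) l atTop :=
    hr.atTop_mul_pos (norm_pos_iff.2 hs₀) hs.norm
  have h2 : Tendsto (fun a => ‖(r a * s a) ^ d‖) l atTop := by
    simp only [norm_pow, norm_mul]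
    exact (tendsto_pow_atTop hd).comp h1
  exact not_tendsto_nhds_of_tendsto_atTop h2 _ h.norm

/-- A second difference that kills the powers of the first two forms. -/
theorem second_difference_eq (hd : d ≠ 0) {u₁ u₂ u₃ x y : Fin n → ℂ} {c : ℂ}
    (h₁ : u₁ ⬝ᵥ x = 0) (h₂ : u₂ ⬝ᵥ y = 0) (h₃ : u₃ ⬝ᵥ x = c) (h₃' : u₃ ⬝ᵥ y = c) :
    ((u₁ ⬝ᵥ (x + y)) ^ d + (u₂ ⬝ᵥ (x + y)) ^ d + (u₃ ⬝ᵥ (x + y)) ^ d)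
      - ((u₁ ⬝ᵥ x) ^ d + (u₂ ⬝ᵥ x) ^ d + (u₃ ⬝ᵥ x) ^ d)
      - ((u₁ ⬝ᵥ y) ^ d + (u₂ ⬝ᵥ y) ^ d + (u₃ ⬝ᵥ y) ^ d) = (2 ^ d - 2) * c ^ d := by
  simp only [dotProduct_add, h₁, h₂, h₃, h₃', zero_pow hd, ← two_mul, mul_pow, zero_add, add_zero]
  ring

theorem two_pow_sub_two_ne_zero (hd : 2 ≤ d) : (2 ^ d - 2 : ℂ) ≠ 0 := by
  rw [sub_ne_zero]
  have : 2 ^ 1 < 2 ^ d := Nat.pow_lt_pow_right (by norm_num) (by omega)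
  exact_mod_cast this.ne'

/-- Otherwise there are convergent points in the kernels of the first and second forms where the
third direction has a common value with nonzero limit. The second difference then leaves a multiple
of an unbounded power. The points move with the parameter, hence the need for continuous
convergence. -/
theorem PowerSumTendsto.proportional_or [l.NeBot] (hd : 2 ≤ d)
    (h : PowerSumTendsto l d v₁ v₂ v₃ g) {r₁ r₂ r₃ : α → ℂ} {u₁ u₂ u₃ : α → Fin n → ℂ}
    {w₁ w₂ w₃ : Fin n → ℂ} (h₁ : ∀ a, v₁ a = r₁ a • u₁ a) (h₂ : ∀ a, v₂ a = r₂ a • u₂ a)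
    (h₃ : ∀ a, v₃ a = r₃ a • u₃ a) (hu₁ : Tendsto u₁ l (𝓝 w₁)) (hu₂ : Tendsto u₂ l (𝓝 w₂))
    (hu₃ : Tendsto u₃ l (𝓝 w₃)) (hr : Tendsto (fun a => ‖r₃ a‖) l atTop) :
    Proportional w₁ w₃ ∨ Proportional w₂ w₃ := by
  by_contra! hcon
  simp only [Proportional, not_forall] at hcon
  obtain ⟨⟨e, z, hez⟩, ⟨e', z', hez'⟩⟩ := hcon
  let x₁ : (Fin n → ℂ) → Fin n → ℂ := fun u => (u ⬝ᵥ e) • z - (u ⬝ᵥ z) • e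
  let x₂ : (Fin n → ℂ) → Fin n → ℂ := fun u => (u ⬝ᵥ e') • z' - (u ⬝ᵥ z') • e'
  have ht : ∀ {u : α → Fin n → ℂ} {w}, Tendsto u l (𝓝 w) → ∀ e z : Fin n → ℂ,
      Tendsto (fun a => (u a ⬝ᵥ e) • z - (u a ⬝ᵥ z) • e) l (𝓝 ((w ⬝ᵥ e) • z - (w ⬝ᵥ z) • e)) :=
    fun hu e z => ((hu.dotProduct tendsto_const_nhds).smul_const z).sub
      ((hu.dotProduct tendsto_const_nhds).smul_const e)
  have hx₁ : Tendsto (fun a => x₁ (u₁ a)) l (𝓝 (x₁ w₁)) := ht hu₁ e z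
  have hx₂ : Tendsto (fun a => x₂ (u₂ a)) l (𝓝 (x₂ w₂)) := ht hu₂ e' z'
  have hb := hu₃.dotProduct hx₁
  have hc := hu₃.dotProduct hx₂
  have hb0 : w₃ ⬝ᵥ x₁ w₁ ≠ 0 := by
    simp only [x₁, dotProduct_sub, dotProduct_smul, smul_eq_mul, sub_ne_zero]
    exact hez
  have hc0 : w₃ ⬝ᵥ x₂ w₂ ≠ 0 := by
    simp only [x₂, dotProduct_sub, dotProduct_smul, smul_eq_mul, sub_ne_zero]
    exact hez'
  -- Cross-scaling gives the third direction the same value on both points.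
  have hX := hc.smul hx₁
  have hY := hb.smul hx₂
  have hd0 : d ≠ 0 := by omega
  refine not_tendsto_pow_mul hd0 hr (hb.mul hc) (mul_ne_zero hb0 hc0)
    (((((h _ _ (hX.add hY)).sub (h _ _ hX)).sub (h _ _ hY)).div_const (2 ^ d - 2)).congr
      fun a => ?_)
  have k₁ : u₁ a ⬝ᵥ x₁ (u₁ a) = 0 := by
    simp only [x₁, dotProduct_sub, dotProduct_smul, smul_eq_mul]
    ring
  have k₂ : u₂ a ⬝ᵥ x₂ (u₂ a) = 0 := by
    simp only [x₂, dotProduct_sub, dotProduct_smul, smul_eq_mul]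
    ring
  rw [div_eq_iff (two_pow_sub_two_ne_zero hd), mul_comm, h₁, h₂, h₃]
  refine second_difference_eq hd0 ?_ ?_ ?_ ?_
  · simp [smul_dotProduct, dotProduct_smul, k₁]
  · simp [smul_dotProduct, dotProduct_smul, k₂]
  · simp only [smul_dotProduct, dotProduct_smul, smul_eq_mul]
    ring
  · simp only [smul_dotProduct, dotProduct_smul, smul_eq_mul]
    ring

theorem PowerSumTendsto.exists_eq_of_proportional [l.NeBot] (hd : 2 ≤ d)
    (h : PowerSumTendsto l d v₁ v₂ v₃ g) {r₁ r₂ r₃ : α → ℂ} {u₁ u₂ u₃ : α → Fin n → ℂ}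
    {w₁ w₂ w₃ : Fin n → ℂ} (h₁ : ∀ a, v₁ a = r₁ a • u₁ a) (h₂ : ∀ a, v₂ a = r₂ a • u₂ a)
    (h₃ : ∀ a, v₃ a = r₃ a • u₃ a) (hu₁ : Tendsto u₁ l (𝓝 w₁)) (hu₂ : Tendsto u₂ l (𝓝 w₂))
    (hu₃ : Tendsto u₃ l (𝓝 w₃)) (hw₁ : w₁ ≠ 0) (hw₂ : w₂ ≠ 0) (hw₃ : w₃ ≠ 0)
    (h₁₂ : Proportional w₁ w₂) (h₁₃ : Proportional w₁ w₃) :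
    ∃ A B C : Fin n → ℂ,
      (∀ x, g x = (A ⬝ᵥ x) ^ (d - 1) * (B ⬝ᵥ x) + (A ⬝ᵥ x) ^ (d - 2) * (C ⬝ᵥ x) ^ 2) ∧
      (r₁ = 0 → u₁ = u₂ → C = 0) := by
  obtain ⟨e, he⟩ := exists_dotProduct_ne_zero hw₁
  set A : Fin n → ℂ := (w₁ ⬝ᵥ e)⁻¹ • w₁ with hA
  let R : Fin 3 → α → ℂ := ![r₁, r₂, r₃]
  let u : Fin 3 → α → Fin n → ℂ := ![u₁, u₂, u₃]
  let w : Fin 3 → Fin n → ℂ := ![w₁, w₂, w₃]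
  have hu : ∀ k, Tendsto (u k) l (𝓝 (w k)) := by
    intro k
    fin_cases k <;> assumption
  have hwe : ∀ k, w k ⬝ᵥ e ≠ 0 := by
    intro k
    fin_cases k
    · exact he
    · exact h₁₂.dotProduct_ne_zero hw₂ he
    · exact h₁₃.dotProduct_ne_zero hw₃ he
  have hprop : ∀ k, (w k ⬝ᵥ e)⁻¹ • w k = A := by
    have key : ∀ v : Fin n → ℂ, Proportional w₁ v → v ⬝ᵥ e ≠ 0 → (v ⬝ᵥ e)⁻¹ • v = A := by
      intro v hv hve
      ext i
      have := hv e (Pi.single i 1)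
      simp only [dotProduct_single_one] at this
      simp only [hA, Pi.smul_apply, smul_eq_mul]
      field_simp
      linear_combination this
    intro k
    fin_cases k
    · rfl
    · exact key _ h₁₂ (hwe 1)
    · exact key _ h₁₃ (hwe 2)
  let W : Fin 3 → α → ℂ := fun k a => (R k a * (u k a ⬝ᵥ e)) ^ d
  let m : Fin 3 → α → Fin n → ℂ := fun k a => (u k a ⬝ᵥ e)⁻¹ • u k a - A
  have hue : ∀ k, Tendsto (fun a => u k a ⬝ᵥ e) l (𝓝 (w k ⬝ᵥ e)) := fun k =>
    (hu k).dotProduct tendsto_const_nhds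
  have hm : ∀ k, Tendsto (m k) l (𝓝 0) := fun k => by
    have := (((hue k).inv₀ (hwe k)).smul (hu k)).sub_const A
    rwa [hprop, sub_self] at this
  -- Here A ⬝ᵥ e = 1 and m k ⬝ᵥ e = 0 wherever u k ⬝ᵥ e ≠ 0, so the k-th normalised form takes the
  -- value σ + m k ⬝ᵥ x at this point. Setting σ = A ⬝ᵥ x later recovers g x.
  have hlim : ∀ x σ, Tendsto (fun a => ∑ k, W k a * (σ + m k a ⬝ᵥ x) ^ d) l
      (𝓝 (g (x + (σ - A ⬝ᵥ x) • e))) := fun x σ => by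
    refine (h _ _ tendsto_const_nhds).congr' ?_
    filter_upwards [(hue 0).eventually_ne (hwe 0), (hue 1).eventually_ne (hwe 1),
      (hue 2).eventually_ne (hwe 2)] with a n₀ n₁ n₂
    have hk : ∀ k, u k a ⬝ᵥ e ≠ 0 → (R k a • u k a ⬝ᵥ (x + (σ - A ⬝ᵥ x) • e)) ^ d =
        W k a * (σ + m k a ⬝ᵥ x) ^ d := by
      intro k hk
      rw [← mul_pow]
      congr 1
      simp only [m, smul_dotProduct, dotProduct_add, dotProduct_smul, sub_dotProduct, smul_eq_mul]
      field_simp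
      ring
    rw [Fin.sum_univ_three, ← hk 0 n₀, ← hk 1 n₁, ← hk 2 n₂, h₁, h₂, h₃]
    rfl
  obtain ⟨t, B, C, hg, hC⟩ := exists_eq_of_tendsto_collapse hd hm hlim
  clear_value A
  refine ⟨A, t • A + B, C, fun x => ?_, fun hr huu => hC ?_ ?_⟩
  · have := hg x (A ⬝ᵥ x)
    rw [sub_self, zero_smul, add_zero] at this
    obtain ⟨k, rfl⟩ := Nat.exists_eq_add_of_le' hd
    rw [this, add_dotProduct, smul_dotProduct, smul_eq_mul, show k + 2 - 1 = k + 1 by omega,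
      Nat.add_sub_cancel]
    ring
  · funext a
    simp [W, R, hr, show d ≠ 0 by omega]
  · simp [m, u, huu]

theorem PowerSumTendsto.sub_left {v₀ : Fin n → ℂ} (h : PowerSumTendsto l d v₁ v₂ v₃ g)
    (hv : Tendsto v₁ l (𝓝 v₀)) (hd : d ≠ 0) :
    PowerSumTendsto l d 0 v₂ v₃ (fun x => g x - (v₀ ⬝ᵥ x) ^ d) := fun y y₀ hy => by
  refine ((h y y₀ hy).sub ((hv.dotProduct hy).pow d)).congr fun a => ?_
  simp only [Pi.zero_apply, zero_dotProduct, zero_pow hd]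
  ring

theorem PowerSumTendsto.classify_two {U : Ultrafilter α} (hd : 2 ≤ d)
    (h : PowerSumTendsto U d 0 v₂ v₃ g) :
    (∃ A B : Fin n → ℂ, ∀ x, g x = (A ⬝ᵥ x) ^ d + (B ⬝ᵥ x) ^ d) ∨
      ∃ A B : Fin n → ℂ, ∀ x, g x = (A ⬝ᵥ x) ^ (d - 1) * (B ⬝ᵥ x) := by
  have hd0 : d ≠ 0 := by omega
  have conv : ∀ {v₂ v₃ : α → Fin n → ℂ} {A : Fin n → ℂ}, PowerSumTendsto U d 0 v₂ v₃ g →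
      Tendsto v₂ U (𝓝 A) → ∃ A B : Fin n → ℂ, ∀ x, g x = (A ⬝ᵥ x) ^ d + (B ⬝ᵥ x) ^ d := by
    intro v₂ v₃ A h hA
    have h' := h.rotate.sub_left hA hd0
    rcases U.tendsto_or_diverges v₃ with ⟨B, hB⟩ | ⟨r, u, u₀, hu₀, hu, hr, hv⟩
    · refine ⟨A, B, fun x => ?_⟩
      have := tendsto_nhds_unique (h'.rotate.rotate _ _ (tendsto_const_nhds (x := x)))
        (by simpa [hd0] using (hB.dotProduct (tendsto_const_nhds (x := x))).pow d)
      rw [← this]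
      ring
    · obtain ⟨x, hx⟩ := exists_dotProduct_ne_zero hu₀
      refine (not_tendsto_pow_mul hd0 hr (hu.dotProduct (tendsto_const_nhds (x := x))) hx
        ((h' _ _ (tendsto_const_nhds (x := x))).congr fun a => ?_)).elim
      simp [hv, hd0]
  rcases U.tendsto_or_diverges v₂ with ⟨A, hA⟩ | ⟨r₂, u₂, w₂, hw₂, hu₂, hr₂, hv₂⟩
  · exact Or.inl (conv h hA)
  rcases U.tendsto_or_diverges v₃ with ⟨A, hA⟩ | ⟨r₃, u₃, w₃, hw₃, hu₃, hr₃, hv₃⟩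
  · refine Or.inl (conv (v₂ := v₃) (v₃ := v₂) (fun y y₀ hy => ?_) hA)
    exact (h y y₀ hy).congr fun a => by ring
  -- The absent form becomes zero times `u₂`, which triggers the clause C = 0.
  have hz : ∀ a, (0 : α → Fin n → ℂ) a = (0 : α → ℂ) a • u₂ a := fun a => by simp
  have hp := (or_self_iff).1 (h.proportional_or hd hz hv₂ hv₃ hu₂ hu₂ hu₃ hr₃)
  obtain ⟨A, B, C, hg, hC⟩ := h.exists_eq_of_proportional hd hz hv₂ hv₃ hu₂ hu₂ hu₃ hw₂ hw₂ hw₃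
    (fun x y => by ring) hp
  refine Or.inr ⟨A, B, fun x => ?_⟩
  simp [hg x, hC rfl rfl]

theorem PowerSumTendsto.classify {U : Ultrafilter α} (hd : 2 ≤ d)
    (h : PowerSumTendsto U d v₁ v₂ v₃ g) :
    ∃ A B C : Fin n → ℂ,
      (∀ x, g x = (A ⬝ᵥ x) ^ d + (B ⬝ᵥ x) ^ d + (C ⬝ᵥ x) ^ d) ∨
      (∀ x, g x = (A ⬝ᵥ x) ^ d + (B ⬝ᵥ x) ^ (d - 1) * (C ⬝ᵥ x)) ∨
      (∀ x, g x = (A ⬝ᵥ x) ^ (d - 1) * (B ⬝ᵥ x) + (A ⬝ᵥ x) ^ (d - 2) * (C ⬝ᵥ x) ^ 2) := by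
  have hd0 : d ≠ 0 := by omega
  have conv : ∀ {v₁ v₂ v₃ : α → Fin n → ℂ} {A : Fin n → ℂ}, PowerSumTendsto U d v₁ v₂ v₃ g →
      Tendsto v₁ U (𝓝 A) → ∃ A B C : Fin n → ℂ,
      (∀ x, g x = (A ⬝ᵥ x) ^ d + (B ⬝ᵥ x) ^ d + (C ⬝ᵥ x) ^ d) ∨
      (∀ x, g x = (A ⬝ᵥ x) ^ d + (B ⬝ᵥ x) ^ (d - 1) * (C ⬝ᵥ x)) ∨
      (∀ x, g x = (A ⬝ᵥ x) ^ (d - 1) * (B ⬝ᵥ x) + (A ⬝ᵥ x) ^ (d - 2) * (C ⬝ᵥ x) ^ 2) := by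
    intro v₁ v₂ v₃ A h hA
    rcases (h.sub_left hA hd0).classify_two hd with ⟨B, C, hBC⟩ | ⟨B, C, hBC⟩
    · exact ⟨A, B, C, Or.inl fun x => by linear_combination hBC x⟩
    · exact ⟨A, B, C, Or.inr (Or.inl fun x => by linear_combination hBC x)⟩
  rcases U.tendsto_or_diverges v₁ with ⟨A, hA⟩ | ⟨r₁, u₁, w₁, hw₁, hu₁, hr₁, hv₁⟩
  · exact conv h hA
  rcases U.tendsto_or_diverges v₂ with ⟨A, hA⟩ | ⟨r₂, u₂, w₂, hw₂, hu₂, hr₂, hv₂⟩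
  · exact conv h.rotate hA
  rcases U.tendsto_or_diverges v₃ with ⟨A, hA⟩ | ⟨r₃, u₃, w₃, hw₃, hu₃, hr₃, hv₃⟩
  · exact conv h.rotate.rotate hA
  have p₃ := h.proportional_or hd hv₁ hv₂ hv₃ hu₁ hu₂ hu₃ hr₃
  have p₁ := h.rotate.proportional_or hd hv₂ hv₃ hv₁ hu₂ hu₃ hu₁ hr₁
  have p₂ := h.rotate.rotate.proportional_or hd hv₃ hv₁ hv₂ hu₃ hu₁ hu₂ hr₂
  -- A graph on three vertices without isolated vertex is connected.
  have hp : Proportional w₁ w₂ ∧ Proportional w₁ w₃ := by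
    rcases p₁ with p₁ | p₁ <;> rcases p₂ with p₂ | p₂ <;> rcases p₃ with p₃ | p₃
    all_goals first
      | exact ⟨p₁.symm, p₃⟩
      | exact ⟨p₂, p₃⟩
      | exact ⟨p₁.symm, p₁.symm.trans p₃ hw₂⟩
      | exact ⟨p₁.symm.trans p₂ hw₃, p₁.symm⟩
      | exact ⟨p₁.symm, p₁.symm.trans p₂.symm hw₂⟩
      | exact ⟨p₂, p₁.symm⟩
  obtain ⟨A, B, C, hg, -⟩ := h.exists_eq_of_proportional hd hv₁ hv₂ hv₃ hu₁ hu₂ hu₃ hw₁ hw₂ hw₃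
    hp.1 hp.2
  exact ⟨A, B, C, Or.inr (Or.inr hg)⟩

end Classification

/-! ### The conic form has none of the three shapes -/

section ConicAndTangent

variable {a : ℂ} {d : ℕ} {α₁ β₁ γ₁ α₂ β₂ γ₂ α₃ β₃ γ₃ : ℂ}

theorem eq_zero_of_translate_mul {p q c : ℂ}
    (h : ∀ y z, a + (y + p) * (z + q) = a + y * z + c) : p = 0 ∧ q = 0 := by
  have h0 := h 0 0
  have h1 := h 1 0
  have h2 := h 0 1
  exact ⟨by linear_combination h2 - h0, by linear_combination h1 - h0⟩

/-- Translation along a common kernel direction in the y, z plane preserves the right side, hence yz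
at x = 1. -/
theorem eq_zero_of_common_kernel {G : ℂ → ℂ → ℂ → ℂ}
    (hF : ∀ x y z, x ^ (d - 2) * (a * x ^ 2 + y * z) =
      G (α₁ * x + β₁ * y + γ₁ * z) (α₂ * x + β₂ * y + γ₂ * z) (α₃ * x + β₃ * y + γ₃ * z))
    {p q : ℂ} (h₁ : β₁ * p + γ₁ * q = 0) (h₂ : β₂ * p + γ₂ * q = 0) (h₃ : β₃ * p + γ₃ * q = 0) :
    p = 0 ∧ q = 0 := by
  refine eq_zero_of_translate_mul (a := a) (c := 0) fun y z => ?_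
  have e := hF 1 y z
  have e' := hF 1 (y + p) (z + q)
  rw [show α₁ * 1 + β₁ * (y + p) + γ₁ * (z + q) = α₁ * 1 + β₁ * y + γ₁ * z by
      linear_combination h₁,
    show α₂ * 1 + β₂ * (y + p) + γ₂ * (z + q) = α₂ * 1 + β₂ * y + γ₂ * z by
      linear_combination h₂,
    show α₃ * 1 + β₃ * (y + p) + γ₃ * (z + q) = α₃ * 1 + β₃ * y + γ₃ * z by
      linear_combination h₃, ← e, one_pow] at e'
  linear_combination e'

theorem exists_mul_add_mul_eq_one {β γ : ℂ} (h : ¬(β = 0 ∧ γ = 0)) :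
    ∃ y z, β * y + γ * z = 1 := by
  by_cases hβ : β = 0
  · have hγ : γ ≠ 0 := fun hγ => h ⟨hβ, hγ⟩
    exact ⟨0, γ⁻¹, by simp [hγ]⟩
  · exact ⟨β⁻¹, 0, by simp [hβ]⟩

/-- At x = 0 the three powers sum to zero. The second-difference trick and evaluation on kernels
make all 2 × 2 minors vanish, so each form's kernel direction is common to all three. -/
theorem conic_ne_sum_of_powers (hd : 2 < d)
    (hF : ∀ x y z, x ^ (d - 2) * (a * x ^ 2 + y * z) =
      (α₁ * x + β₁ * y + γ₁ * z) ^ d + (α₂ * x + β₂ * y + γ₂ * z) ^ d +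
        (α₃ * x + β₃ * y + γ₃ * z) ^ d) : False := by
  have hd0 : d ≠ 0 := by omega
  have h0 : ∀ y z, (β₁ * y + γ₁ * z) ^ d + (β₂ * y + γ₂ * z) ^ d + (β₃ * y + γ₃ * z) ^ d = 0 :=
    fun y z => by simpa [show d - 2 ≠ 0 by omega] using (hF 0 y z).symm
  have hker := fun {p q : ℂ} => eq_zero_of_common_kernel (p := p) (q := q)
    (G := fun A B C => A ^ d + B ^ d + C ^ d) hF
  obtain ⟨D₁₂, h₁₂⟩ : ∃ D, D = β₁ * γ₂ - β₂ * γ₁ := ⟨_, rfl⟩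
  obtain ⟨D₁₃, h₁₃⟩ : ∃ D, D = β₁ * γ₃ - β₃ * γ₁ := ⟨_, rfl⟩
  obtain ⟨D₂₃, h₂₃⟩ : ∃ D, D = β₂ * γ₃ - β₃ * γ₂ := ⟨_, rfl⟩
  have e₁ : D₁₂ ^ d + D₁₃ ^ d = 0 := by
    have := h0 (-γ₁) β₁
    rwa [show β₁ * -γ₁ + γ₁ * β₁ = 0 by ring, zero_pow hd0, zero_add,
      show β₂ * -γ₁ + γ₂ * β₁ = D₁₂ by rw [h₁₂]; ring,
      show β₃ * -γ₁ + γ₃ * β₁ = D₁₃ by rw [h₁₃]; ring] at this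
  have e₂ : D₁₂ ^ d + (-D₂₃) ^ d = 0 := by
    have := h0 γ₂ (-β₂)
    rwa [show β₂ * γ₂ + γ₂ * -β₂ = 0 by ring, zero_pow hd0, add_zero,
      show β₁ * γ₂ + γ₁ * -β₂ = D₁₂ by rw [h₁₂]; ring,
      show β₃ * γ₂ + γ₃ * -β₂ = -D₂₃ by rw [h₂₃]; ring] at this
  have hsome : D₂₃ * D₁₃ = 0 := by
    have k₀ := h0 (-γ₁ * D₂₃ + -γ₂ * D₁₃) (β₁ * D₂₃ + β₂ * D₁₃)
    have k₁ := h0 (-γ₁ * D₂₃) (β₁ * D₂₃)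
    have k₂ := h0 (-γ₂ * D₁₃) (β₂ * D₁₃)
    rw [show β₁ * (-γ₁ * D₂₃ + -γ₂ * D₁₃) + γ₁ * (β₁ * D₂₃ + β₂ * D₁₃) = -D₁₂ * D₁₃ by
        rw [h₁₂]; ring,
      show β₂ * (-γ₁ * D₂₃ + -γ₂ * D₁₃) + γ₂ * (β₁ * D₂₃ + β₂ * D₁₃) = D₁₂ * D₂₃ by
        rw [h₁₂]; ring,
      show β₃ * (-γ₁ * D₂₃ + -γ₂ * D₁₃) + γ₃ * (β₁ * D₂₃ + β₂ * D₁₃) = 2 * (D₂₃ * D₁₃) by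
        rw [h₁₃, h₂₃]; ring] at k₀
    rw [show β₁ * (-γ₁ * D₂₃) + γ₁ * (β₁ * D₂₃) = 0 by ring, zero_pow hd0,
      show β₂ * (-γ₁ * D₂₃) + γ₂ * (β₁ * D₂₃) = D₁₂ * D₂₃ by rw [h₁₂]; ring,
      show β₃ * (-γ₁ * D₂₃) + γ₃ * (β₁ * D₂₃) = D₂₃ * D₁₃ by rw [h₁₃]; ring] at k₁
    rw [show β₂ * (-γ₂ * D₁₃) + γ₂ * (β₂ * D₁₃) = 0 by ring, zero_pow hd0,
      show β₁ * (-γ₂ * D₁₃) + γ₁ * (β₂ * D₁₃) = -D₁₂ * D₁₃ by rw [h₁₂]; ring,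
      show β₃ * (-γ₂ * D₁₃) + γ₃ * (β₂ * D₁₃) = D₂₃ * D₁₃ by rw [h₂₃]; ring] at k₂
    rw [mul_pow 2] at k₀
    have : (2 ^ d - 2) * (D₂₃ * D₁₃) ^ d = 0 := by linear_combination k₀ - k₁ - k₂
    exact (pow_eq_zero_iff hd0).1
      ((mul_eq_zero.1 this).resolve_left (two_pow_sub_two_ne_zero (by omega)))
  have hD₁₂ : D₁₂ = 0 := by
    rcases mul_eq_zero.1 hsome with h | h
    · simpa [h, hd0] using e₂
    · simpa [h, hd0] using e₁
  have hD₁₃ : D₁₃ = 0 := by simpa [hD₁₂, hd0] using e₁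
  have hD₂₃ : D₂₃ = 0 := by simpa [hD₁₂, hd0] using e₂
  obtain ⟨hγ₁, hβ₁⟩ := hker (p := -γ₁) (q := β₁) (by ring)
    (by linear_combination hD₁₂ - h₁₂) (by linear_combination hD₁₃ - h₁₃)
  obtain ⟨hγ₂, hβ₂⟩ := hker (p := -γ₂) (q := β₂)
    (by linear_combination h₁₂ - hD₁₂) (by ring) (by linear_combination hD₂₃ - h₂₃)
  obtain ⟨hγ₃, hβ₃⟩ := hker (p := -γ₃) (q := β₃)
    (by linear_combination h₁₃ - hD₁₃) (by linear_combination h₂₃ - hD₂₃) (by ring)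
  exact one_ne_zero (hker (p := 1) (q := 0) (by simp [hβ₁]) (by simp [hβ₂]) (by simp [hβ₃])).1

/-- At x = 0 the kernel direction of the second form kills the first, and then the third by
translation from a point where the second form is 1. -/
theorem conic_ne_power_add_tangent (hd : 2 < d)
    (hF : ∀ x y z, x ^ (d - 2) * (a * x ^ 2 + y * z) =
      (α₁ * x + β₁ * y + γ₁ * z) ^ d +
        (α₂ * x + β₂ * y + γ₂ * z) ^ (d - 1) * (α₃ * x + β₃ * y + γ₃ * z)) : False := by
  have hd0 : d ≠ 0 := by omega
  have hd1 : d - 1 ≠ 0 := by omega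
  have h0 : ∀ y z, (β₁ * y + γ₁ * z) ^ d + (β₂ * y + γ₂ * z) ^ (d - 1) * (β₃ * y + γ₃ * z) = 0 :=
    fun y z => by simpa [show d - 2 ≠ 0 by omega] using (hF 0 y z).symm
  have hker := fun {p q : ℂ} => eq_zero_of_common_kernel (p := p) (q := q)
    (G := fun A B C => A ^ d + B ^ (d - 1) * C) hF
  by_cases hμ : β₂ = 0 ∧ γ₂ = 0
  · obtain ⟨rfl, rfl⟩ := hμ
    have hβ₁ : β₁ = 0 := by simpa [hd0, hd1] using h0 1 0
    have hγ₁ : γ₁ = 0 := by simpa [hd0, hd1] using h0 0 1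
    obtain ⟨hγ₃, hβ₃⟩ := hker (p := -γ₃) (q := β₃) (by simp [hβ₁, hγ₁]) (by simp) (by ring)
    exact one_ne_zero (hker (p := 1) (q := 0) (by simp [hβ₁]) (by simp) (by simp [hβ₃])).1
  · obtain ⟨y, z, hyz⟩ := exists_mul_add_mul_eq_one hμ
    have k₁ : β₁ * -γ₂ + γ₁ * β₂ = 0 := by
      have := h0 (-γ₂) β₂
      rw [show β₂ * -γ₂ + γ₂ * β₂ = 0 by ring, zero_pow hd1, zero_mul, add_zero] at this
      exact (pow_eq_zero_iff hd0).1 this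
    have k₃ : β₃ * -γ₂ + γ₃ * β₂ = 0 := by
      have e := h0 y z
      have e' := h0 (y + -γ₂) (z + β₂)
      rw [show β₁ * (y + -γ₂) + γ₁ * (z + β₂) = β₁ * y + γ₁ * z by linear_combination k₁,
        show β₂ * (y + -γ₂) + γ₂ * (z + β₂) = 1 by linear_combination hyz, one_pow] at e'
      rw [hyz, one_pow] at e
      linear_combination e' - e
    obtain ⟨hγ, hβ⟩ := hker k₁ (by ring) k₃
    exact hμ ⟨hβ, neg_eq_zero.1 hγ⟩

/-- If the first form involves only x, then at x = 1 translation along the kernel of the third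
changes yz by a constant. Otherwise, on the line where x = 0 and the first form is 1, comparing
coefficients in s shows that the line's direction is a common kernel. -/
theorem conic_ne_osculating (hd : 2 < d)
    (hF : ∀ x y z, x ^ (d - 2) * (a * x ^ 2 + y * z) =
      (α₁ * x + β₁ * y + γ₁ * z) ^ (d - 1) * (α₂ * x + β₂ * y + γ₂ * z) +
        (α₁ * x + β₁ * y + γ₁ * z) ^ (d - 2) * (α₃ * x + β₃ * y + γ₃ * z) ^ 2) : False := by
  by_cases hμ : β₁ = 0 ∧ γ₁ = 0
  · obtain ⟨rfl, rfl⟩ := hμ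
    have h1 : ∀ y z, a + y * z = α₁ ^ (d - 1) * (α₂ + β₂ * y + γ₂ * z) +
        α₁ ^ (d - 2) * (α₃ + β₃ * y + γ₃ * z) ^ 2 := fun y z => by
      simpa using hF 1 y z
    obtain ⟨hγ, hβ⟩ := eq_zero_of_translate_mul (a := a) (p := -γ₃) (q := β₃)
      (c := α₁ ^ (d - 1) * (β₂ * -γ₃ + γ₂ * β₃)) fun y z => by
        linear_combination h1 (y + -γ₃) (z + β₃) - h1 y z
    have hγ₃ : γ₃ = 0 := neg_eq_zero.1 hγ
    subst hγ₃ hβ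
    exact one_ne_zero (eq_zero_of_translate_mul (a := a) (p := 1) (q := 0)
      (c := α₁ ^ (d - 1) * β₂) fun y z => by
        linear_combination h1 (y + 1) (z + 0) - h1 y z).1
  · obtain ⟨y, z, hyz⟩ := exists_mul_add_mul_eq_one hμ
    have h0 : ∀ s, (β₂ * (y + s * -γ₁) + γ₂ * (z + s * β₁)) +
        (β₃ * (y + s * -γ₁) + γ₃ * (z + s * β₁)) ^ 2 = 0 := fun s => by
      have := hF 0 (y + s * -γ₁) (z + s * β₁)
      rw [show α₁ * 0 + β₁ * (y + s * -γ₁) + γ₁ * (z + s * β₁) = 1 by linear_combination hyz,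
        zero_pow (by omega), one_pow, one_pow] at this
      linear_combination -this
    have k₃ : β₃ * -γ₁ + γ₃ * β₁ = 0 := by
      have : (β₃ * -γ₁ + γ₃ * β₁) ^ 2 = 0 := by
        linear_combination (h0 1 + h0 (-1)) / 2 - h0 0
      exact (pow_eq_zero_iff two_ne_zero).1 this
    have k₂ : β₂ * -γ₁ + γ₂ * β₁ = 0 := by
      linear_combination (h0 1 - h0 (-1)) / 2 - 2 * (β₃ * y + γ₃ * z) * k₃
    obtain ⟨hγ, hβ⟩ := eq_zero_of_common_kernel
      (G := fun A B C => A ^ (d - 1) * B + A ^ (d - 2) * C ^ 2) hF (by ring) k₂ k₃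
    exact hμ ⟨hβ, neg_eq_zero.1 hγ⟩

end ConicAndTangent

/-! ### Border rank and the final reduction -/

section BorderRank

open MvPolynomial

variable {n d : ℕ} {f : MvPolynomial (Fin n) ℂ}

theorem HasBorderWaringDecomposition.mono {r s : ℕ} (hd : d ≠ 0)
    (h : HasBorderWaringDecomposition d f r) (hrs : r ≤ s) :
    HasBorderWaringDecomposition d f s := by
  induction s, hrs using Nat.le_induction with
  | base => exact h
  | succ s _ ih =>
    obtain ⟨ℓ, hℓ, hlim⟩ := ih
    refine ⟨Fin.cons 0 ℓ, fun k => ?_, ?_⟩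
    · refine Fin.cases ?_ (fun k => ?_) k
      · simpa using isHomogeneous_zero _ _ 1
      · simpa using hℓ k
    · simpa [Fin.sum_univ_succ, hd] using hlim

theorem HasBorderWaringDecomposition.exists_powerSumTendsto
    (h : HasBorderWaringDecomposition d f 3) :
    ∃ (U : Ultrafilter ℂ) (v : Fin 3 → ℂ → Fin n → ℂ),
      PowerSumTendsto U d (v 0) (v 1) (v 2) (fun x => eval x f) := by
  obtain ⟨ℓ, hℓ, hlim⟩ := h
  obtain ⟨v, hv⟩ := hlim.exists_tendsto hℓ
  refine ⟨Ultrafilter.of (𝓝[≠] 0), v, fun y y₀ hy => ?_⟩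
  simpa only [Fin.sum_univ_three] using hv _ (Ultrafilter.of_le _) y y₀ hy

theorem hasBorderWaringDecomposition_of_rank_eq {r : ℕ} (h : borderWaringRank d f = r) :
    HasBorderWaringDecomposition d f r := by
  have hlt : borderWaringRank d f < (r + 1 : ℕ) := by
    rw [h]
    exact_mod_cast Nat.lt_succ_self r
  simp only [borderWaringRank, iInf_lt_iff] at hlt
  obtain ⟨s, hs, hsr⟩ := hlt
  have hle : (r : ℕ∞) ≤ s := h ▸ iInf₂_le s hs
  have h1 : s < r + 1 := by exact_mod_cast hsr
  have h2 : r ≤ s := by exact_mod_cast hle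
  obtain rfl : s = r := by omega
  exact hs

/-- A matrix with independent rows has a right inverse; this gives coordinates x, y, z on which the
three forms are independent variables. -/
theorem exists_dual_points {v : Fin 3 → Fin n → ℂ} (hv : LinearIndependent ℂ v) :
    ∃ e : (Fin 3 → ℂ) →ₗ[ℂ] Fin n → ℂ, ∀ k y, v k ⬝ᵥ e y = y k := by
  have hrank : (Matrix.of v).rank = 3 := by
    simpa using LinearIndependent.rank_matrix (M := Matrix.of v) hv
  have hsurj : LinearMap.range (Matrix.of v).mulVecLin = ⊤ :=
    Submodule.eq_top_of_finrank_eq (by simpa [Matrix.rank] using hrank)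
  obtain ⟨e, he⟩ := (Matrix.of v).mulVecLin.exists_rightInverse_of_surjective hsurj
  exact ⟨e, fun k y => congrFun (LinearMap.congr_fun he y) k⟩

theorem linearIndependent_of_linearFormOf {v : Fin 3 → Fin n → ℂ}
    (h : LinearIndependent ℂ fun k => linearFormOf (v k)) : LinearIndependent ℂ v := by
  let T : (Fin n → ℂ) →ₗ[ℂ] MvPolynomial (Fin n) ℂ :=
    Fintype.linearCombination ℂ fun i => (X i : MvPolynomial (Fin n) ℂ)
  refine LinearIndependent.of_comp T ?_
  convert h using 2 with k
  simp [T, Fintype.linearCombination_apply, linearFormOf, smul_eq_C_mul]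

theorem not_hasBorderWaringDecomposition_conic (hd : 2 < d) (a : ℂ) {v : Fin 3 → Fin n → ℂ}
    (hv : LinearIndependent ℂ v) :
    ¬HasBorderWaringDecomposition d (linearFormOf (v 0) ^ (d - 2) *
      (C a * linearFormOf (v 0) ^ 2 + linearFormOf (v 1) * linearFormOf (v 2))) 3 := by
  intro h
  obtain ⟨U, w, hw⟩ := h.exists_powerSumTendsto
  obtain ⟨e, he⟩ := exists_dual_points hv
  have heval : ∀ x y z, eval (e ![x, y, z]) (linearFormOf (v 0) ^ (d - 2) *
      (C a * linearFormOf (v 0) ^ 2 + linearFormOf (v 1) * linearFormOf (v 2))) =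
      x ^ (d - 2) * (a * x ^ 2 + y * z) := fun x y z => by
    simp [he]
  have hlin : ∀ A : Fin n → ℂ, ∃ α β γ : ℂ, ∀ x y z : ℂ,
      A ⬝ᵥ e ![x, y, z] = α * x + β * y + γ * z := fun A =>
    ⟨A ⬝ᵥ e ![1, 0, 0], A ⬝ᵥ e ![0, 1, 0], A ⬝ᵥ e ![0, 0, 1], fun x y z => by
      have : (![x, y, z] : Fin 3 → ℂ) = x • ![1, 0, 0] + y • ![0, 1, 0] + z • ![0, 0, 1] := by
        ext i
        fin_cases i <;> simp
      rw [this]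
      simp only [map_add, map_smul, dotProduct_add, dotProduct_smul, smul_eq_mul]
      ring⟩
  obtain ⟨A, B, C, hg⟩ := hw.classify hd.le
  obtain ⟨α₁, β₁, γ₁, hA⟩ := hlin A
  obtain ⟨α₂, β₂, γ₂, hB⟩ := hlin B
  obtain ⟨α₃, β₃, γ₃, hC⟩ := hlin C
  rcases hg with hg | hg | hg <;> replace hg := fun x y z => (heval x y z).symm.trans (hg _) <;>
    simp only [hA, hB, hC] at hg
  · exact conic_ne_sum_of_powers hd hg
  · exact conic_ne_power_add_tangent hd hg
  · exact conic_ne_osculating hd hg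

end BorderRank

theorem mainTheorem7 (n d : ℕ) :
    (∀ f : MvPolynomial (Fin n) ℂ, f.IsHomogeneous d → borderWaringRank d f = 3 →
      ∃ ℓ₁ ℓ₂ ℓ₃ : MvPolynomial (Fin n) ℂ,
        ℓ₁.IsHomogeneous 1 ∧ ℓ₂.IsHomogeneous 1 ∧ ℓ₃.IsHomogeneous 1 ∧
        (f = ℓ₁ ^ d + ℓ₂ ^ d + ℓ₃ ^ d ∨
          (2 ≤ d ∧
            (f = ℓ₁ ^ d + ℓ₂ ^ (d - 1) * ℓ₃ ∨
              f = ℓ₁ ^ (d - 1) * ℓ₂ + ℓ₁ ^ (d - 2) * ℓ₃ ^ 2)))) ∧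
    (2 < d → ∀ (a : ℂ) (ℓ₁ ℓ₂ ℓ₃ : MvPolynomial (Fin n) ℂ),
      ℓ₁.IsHomogeneous 1 → ℓ₂.IsHomogeneous 1 → ℓ₃.IsHomogeneous 1 →
      LinearIndependent ℂ ![ℓ₁, ℓ₂, ℓ₃] →
      4 ≤ borderWaringRank d
        (ℓ₁ ^ (d - 2) * (MvPolynomial.C a * ℓ₁ ^ 2 + ℓ₂ * ℓ₃))) := by
  constructor
  · intro f hf hrank
    obtain ⟨U, v, hv⟩ :=
      (hasBorderWaringDecomposition_of_rank_eq (r := 3) hrank).exists_powerSumTendsto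
    rcases Nat.lt_or_ge d 2 with hd | hd
    · obtain rfl | rfl : d = 0 ∨ d = 1 := by omega
      -- In degree 0 every power is 1, even of the zero form, so f = 3.
      · refine ⟨0, 0, 0, MvPolynomial.isHomogeneous_zero _ _ 1,
          MvPolynomial.isHomogeneous_zero _ _ 1, MvPolynomial.isHomogeneous_zero _ _ 1,
          Or.inl (MvPolynomial.funext fun x => ?_)⟩
        have := hv _ _ (tendsto_const_nhds (x := x))
        simp only [pow_zero] at this
        simpa using (tendsto_nhds_unique tendsto_const_nhds this).symm
      · exact ⟨f, 0, 0, hf, MvPolynomial.isHomogeneous_zero _ _ 1,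
          MvPolynomial.isHomogeneous_zero _ _ 1, Or.inl (by simp)⟩
    · obtain ⟨A, B, C, hg⟩ := hv.classify hd
      refine ⟨linearFormOf A, linearFormOf B, linearFormOf C, isHomogeneous_linearFormOf A,
        isHomogeneous_linearFormOf B, isHomogeneous_linearFormOf C, ?_⟩
      rcases hg with hg | hg | hg
      · exact Or.inl (MvPolynomial.funext fun x => by simp [hg])
      · exact Or.inr ⟨hd, Or.inl (MvPolynomial.funext fun x => by simp [hg])⟩
      · exact Or.inr ⟨hd, Or.inr (MvPolynomial.funext fun x => by simp [hg])⟩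
  · intro hd a ℓ₁ ℓ₂ ℓ₃ h₁ h₂ h₃ hli
    obtain ⟨v₁, rfl⟩ := exists_eq_linearFormOf h₁
    obtain ⟨v₂, rfl⟩ := exists_eq_linearFormOf h₂
    obtain ⟨v₃, rfl⟩ := exists_eq_linearFormOf h₃
    have hv : LinearIndependent ℂ ![v₁, v₂, v₃] := linearIndependent_of_linearFormOf (by
      convert hli using 1
      ext1 k
      fin_cases k <;> rfl)
    refine le_iInf₂ fun r hr => ?_
    by_contra hlt
    have hr3 : r ≤ 3 := by
      have : r < 4 := by exact_mod_cast not_le.1 hlt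
      omega
    exact not_hasBorderWaringDecomposition_conic hd a hv (hr.mono (by omega) hr3)
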